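/- Let $G=\bigoplus_{i=1}^{\infty}\mathbb Z$ be the discrete group of finitely supported integer sequences, and let $\ell^1(G)$ be the Banach algebra of all functions $f\colon G\to\mathbb C$ with $\|f\|=\sum_{s\in G}|f(s)|<\infty$, with convolution $(f*g)(t)=\sum_{s\in G}f(s)\,g(t-s)$ as product. Let $\ell^1(G)''$ be its bidual, regarded as a Banach algebra under the first Arens product $\Box$: for a Banach algebra $A$ and $\Psi,\Phi\in A''$, $\lambda\in A'$, $a,b\in A$, $$\langle\Psi\,\Box\,\Phi,\lambda\rangle=\langle\Psi,\Phi\cdot\lambda\rangle,\qquad \langle\Phi\cdot\lambda,a\rangle=\langle\Phi,\lambda\cdot a\rangle,\qquad \langle\lambda\cdot a,b\rangle=\langle\lambda,ab\rangle .$$ Then the Jacobson radical of $(\ell^1(G)'',\Box)$ contains an element that is not nilpotent: there is $\Phi\in\operatorname{rad}(\ell^1(G)'')$ such that $\Phi^{\Box n}\neq 0$ for every $n\ge 1$. -/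

import Mathlib

open scoped ENNReal

noncomputable section

/-! ### The convolution algebra `ℓ¹(G)` of a discrete group `G` (written additively) -/

/-- `ℓ¹(G)`: the complex functions on `G` with `‖f‖ = ∑ ‖f s‖ < ∞`. -/
abbrev EllOne (G : Type*) : Type _ := lp (fun _ : G => ℂ) 1

namespace EllOne

variable {G : Type*}

theorem summable_norm (f : EllOne G) : Summable fun s => ‖f s‖ := by
  simpa using (lp.memℓp f).summable (by simp)

theorem norm_eq (f : EllOne G) : ‖f‖ = ∑' s, ‖f s‖ := by
  simpa using lp.norm_eq_tsum_rpow (p := 1) (by simp) f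

theorem norm_apply_le (f : EllOne G) (s : G) : ‖f s‖ ≤ ‖f‖ :=
  lp.norm_apply_le_norm one_ne_zero f s

variable [AddGroup G]

/-- The change of variables `(s, t) ↦ (s, -s + t)`. -/
def shear (G : Type*) [AddGroup G] : G × G ≃ G × G where
  toFun p := (p.1, -p.1 + p.2)
  invFun p := (p.1, p.1 + p.2)
  left_inv p := by simp
  right_inv p := by simp

theorem summable_conv (f g : EllOne G) :
    Summable fun p : G × G => ‖f p.1‖ * ‖g (-p.1 + p.2)‖ := by
  have h : Summable fun p : G × G => ‖f p.1‖ * ‖g p.2‖ :=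
    (summable_norm f).mul_of_nonneg (summable_norm g) (fun _ => norm_nonneg _)
      (fun _ => norm_nonneg _)
  exact (shear G).summable_iff.mpr h

theorem summable_conv_apply (f g : EllOne G) (t : G) :
    Summable fun s => ‖f s‖ * ‖g (-s + t)‖ :=
  (summable_conv f g).prod_symm.prod_factor t

theorem summable_conv_apply' (f g : EllOne G) (t : G) :
    Summable fun s => f s * g (-s + t) :=
  .of_norm (by simpa using summable_conv_apply f g t)

theorem summable_conv_tsum (f g : EllOne G) :
    Summable fun t => ∑' s, ‖f s‖ * ‖g (-s + t)‖ :=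
  (summable_conv f g).prod_symm.prod

theorem tsum_conv (f g : EllOne G) :
    ∑' t, ∑' s, ‖f s‖ * ‖g (-s + t)‖ = ‖f‖ * ‖g‖ := by
  have h := (summable_conv f g).prod_symm.tsum_prod
  simp only [Prod.fst_swap, Prod.snd_swap, Prod.swap_prod_mk] at h
  rw [norm_eq, norm_eq, ← h]
  rw [(summable_norm f).tsum_mul_tsum (summable_norm g)
    ((summable_norm f).mul_of_nonneg (summable_norm g) (fun _ => norm_nonneg _)
      (fun _ => norm_nonneg _))]
  exact ((Equiv.prodComm G G).trans (shear G)).tsum_eq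
    (fun p : G × G => ‖f p.1‖ * ‖g p.2‖)

theorem norm_conv_le (f g : EllOne G) (t : G) :
    ‖∑' s, f s * g (-s + t)‖ ≤ ∑' s, ‖f s‖ * ‖g (-s + t)‖ := by
  simpa using norm_tsum_le_tsum_norm (f := fun s => f s * g (-s + t))
    (by simpa using summable_conv_apply f g t)

theorem summable_norm_conv (f g : EllOne G) :
    Summable fun t => ‖∑' s, f s * g (-s + t)‖ :=
  (summable_conv_tsum f g).of_nonneg_of_le (fun _ => norm_nonneg _) (norm_conv_le f g)

/-- Convolution: `(f * g) t = ∑ s, f s * g (-s + t)`. -/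
instance : Mul (EllOne G) where
  mul f g := ⟨fun t => ∑' s, f s * g (-s + t),
    memℓp_gen (by simpa using summable_norm_conv f g)⟩

theorem mul_apply (f g : EllOne G) (t : G) : (f * g) t = ∑' s, f s * g (-s + t) := rfl

open Classical in
/-- The identity is the point mass at the neutral element. -/
instance : One (EllOne G) where
  one := lp.single 1 0 1

open Classical in
theorem one_apply (t : G) : (1 : EllOne G) t = if t = 0 then 1 else 0 := by
  change (lp.single 1 (0 : G) (1 : ℂ) : EllOne G) t = _
  simp [lp.single_apply, Pi.single_apply]

/-- `ℓ¹(G)` with convolution is a normed ring (complete, since `lp` is). -/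
instance : NormedRing (EllOne G) :=
  { (inferInstance : NormedAddCommGroup (EllOne G)),
    (inferInstance : Mul (EllOne G)),
    (inferInstance : One (EllOne G)) with
    left_distrib := fun f g h => by
      ext t
      simp only [mul_apply, lp.coeFn_add, Pi.add_apply, mul_add]
      exact (summable_conv_apply' f g t).tsum_add (summable_conv_apply' f h t)
    right_distrib := fun f g h => by
      ext t
      simp only [mul_apply, lp.coeFn_add, Pi.add_apply, add_mul]
      exact (summable_conv_apply' f h t).tsum_add (summable_conv_apply' g h t)
    zero_mul := fun f => by ext t; simp [mul_apply]
    mul_zero := fun f => by ext t; simp [mul_apply]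
    one_mul := fun f => by
      ext t
      rw [mul_apply, tsum_eq_single 0 (fun s hs => by simp [one_apply, hs])]
      simp [one_apply]
    mul_one := fun f => by
      ext t
      rw [mul_apply, tsum_eq_single t]
      · simp [one_apply]
      · intro s hs
        have : -s + t ≠ 0 := fun h => hs (by rw [neg_add_eq_zero] at h; exact h)
        simp [one_apply, this]
    mul_assoc := fun f g h => by
      ext t
      have hs : Summable fun p : G × G => f p.1 * g (-p.1 + p.2) * h (-p.2 + t) := by
        refine .of_norm_bounded ((summable_conv f g).mul_right ‖h‖) fun p => ?_
        rw [norm_mul, norm_mul]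
        exact mul_le_mul_of_nonneg_left (norm_apply_le h _) (by positivity)
      calc ∑' s, (∑' r, f r * g (-r + s)) * h (-s + t)
          = ∑' s, ∑' r, f r * g (-r + s) * h (-s + t) := by simp_rw [tsum_mul_right]
        _ = ∑' r, ∑' s, f r * g (-r + s) * h (-s + t) :=
            (Summable.tsum_comm (f := fun r s => f r * g (-r + s) * h (-s + t)) hs)
        _ = ∑' r, f r * ∑' u, g u * h (-u + (-r + t)) := by
            refine tsum_congr fun r => ?_
            rw [← tsum_mul_left, ← (Equiv.addLeft (-r)).tsum_eq
              (fun u => f r * (g u * h (-u + (-r + t))))]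
            refine tsum_congr fun s => ?_
            simp [mul_assoc, add_assoc]
    norm_mul_le := fun f g => by
      rw [← tsum_conv, norm_eq]
      exact (summable_norm_conv f g).tsum_le_tsum (norm_conv_le f g) (summable_conv_tsum f g) }

instance : NormedAlgebra ℂ (EllOne G) :=
  { Algebra.ofModule (R := ℂ) (A := EllOne G)
      (fun c f g => by
        ext t
        simp only [mul_apply, lp.coeFn_smul, Pi.smul_apply, smul_eq_mul, mul_assoc,
          tsum_mul_left])
      (fun c f g => by
        ext t
        simp only [mul_apply, lp.coeFn_smul, Pi.smul_apply, smul_eq_mul, mul_left_comm _ c,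
          tsum_mul_left]) with
    norm_smul_le := norm_smul_le }

end EllOne

/-! ### The bidual of a Banach algebra with the first Arens product -/

/-- The bidual `A''`. -/
abbrev Bidual (A : Type*) [NormedRing A] [NormedAlgebra ℂ A] : Type _ :=
  StrongDual ℂ (StrongDual ℂ A)

namespace Bidual

variable {A : Type*} [NormedRing A] [NormedAlgebra ℂ A]

/-- The right action of `A` on `A'`: `⟨l · a, b⟩ = ⟨l, a b⟩`, as a map of `a`. -/
def dualAct (l : StrongDual ℂ A) : A →L[ℂ] StrongDual ℂ A :=
  (ContinuousLinearMap.compL ℂ A A ℂ l).comp (ContinuousLinearMap.mul ℂ A)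

@[simp] theorem dualAct_apply (l : StrongDual ℂ A) (a b : A) : dualAct l a b = l (a * b) := rfl

theorem norm_dualAct_apply_le (l : StrongDual ℂ A) (a : A) : ‖dualAct l a‖ ≤ ‖l‖ * ‖a‖ :=
  ContinuousLinearMap.opNorm_le_bound _ (by positivity) fun b => by
    rw [dualAct_apply, mul_assoc]
    exact (l.le_opNorm _).trans (mul_le_mul_of_nonneg_left (norm_mul_le a b) (norm_nonneg l))

theorem norm_comp_dualAct_le (Φ : Bidual A) (l : StrongDual ℂ A) :
    ‖Φ.comp (dualAct l)‖ ≤ ‖Φ‖ * ‖l‖ :=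
  ContinuousLinearMap.opNorm_le_bound _ (by positivity) fun a => by
    rw [mul_assoc]
    exact (Φ.le_opNorm _).trans
      (mul_le_mul_of_nonneg_left (norm_dualAct_apply_le l a) (norm_nonneg Φ))

/-- The left action of `A''` on `A'`: `⟨Φ · l, a⟩ = ⟨Φ, l · a⟩`, as a map of `l`. -/
def bidualAct (Φ : Bidual A) : StrongDual ℂ A →L[ℂ] StrongDual ℂ A :=
  LinearMap.mkContinuous
    { toFun := fun l => Φ.comp (dualAct l)
      map_add' := fun l m => by
        ext a
        exact map_add Φ (dualAct l a) (dualAct m a)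
      map_smul' := fun c l => by
        ext a
        exact map_smul Φ c (dualAct l a) }
    ‖Φ‖ (norm_comp_dualAct_le Φ)

@[simp] theorem bidualAct_apply (Φ : Bidual A) (l : StrongDual ℂ A) (a : A) :
    bidualAct Φ l a = Φ (dualAct l a) := rfl

/-- The first Arens product: `⟨Ψ □ Φ, l⟩ = ⟨Ψ, Φ · l⟩`. -/
instance : Mul (Bidual A) where
  mul Ψ Φ := Ψ.comp (bidualAct Φ)

theorem mul_apply (Ψ Φ : Bidual A) (l : StrongDual ℂ A) : (Ψ * Φ) l = Ψ (bidualAct Φ l) := rfl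

/-- The identity of `A''` is the image of the identity of `A`. -/
instance : One (Bidual A) where
  one := NormedSpace.inclusionInDoubleDual ℂ A 1

theorem one_apply (l : StrongDual ℂ A) : (1 : Bidual A) l = l 1 := rfl

/-- `A''` with the first Arens product is a normed ring. -/
instance : NormedRing (Bidual A) :=
  { (inferInstance : NormedAddCommGroup (Bidual A)),
    (inferInstance : Mul (Bidual A)),
    (inferInstance : One (Bidual A)) with
    left_distrib := fun Φ Ψ Θ => by
      ext l
      exact map_add Φ (bidualAct Ψ l) (bidualAct Θ l)
    right_distrib := fun Φ Ψ Θ => rfl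
    zero_mul := fun Φ => rfl
    mul_zero := fun Φ => by
      ext l
      exact map_zero Φ
    one_mul := fun Φ => by
      ext l
      rw [mul_apply, one_apply, bidualAct_apply]
      congr 1
      ext b
      simp
    mul_one := fun Φ => by
      ext l
      rw [mul_apply]
      congr 1
      ext b
      simp [one_apply]
    mul_assoc := fun Φ Ψ Θ => by
      ext l
      simp only [mul_apply]
      congr 1
      ext a
      simp only [bidualAct_apply, mul_apply]
      congr 1
      ext b
      simp only [bidualAct_apply, dualAct_apply]
      congr 1
      ext c
      simp [mul_assoc]
    norm_mul_le := fun Ψ Φ =>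
      ContinuousLinearMap.opNorm_le_bound _ (by positivity) fun l => by
        rw [mul_apply, mul_assoc]
        exact (Ψ.le_opNorm _).trans
          (mul_le_mul_of_nonneg_left (norm_comp_dualAct_le Φ l) (norm_nonneg Ψ)) }

instance : NormedAlgebra ℂ (Bidual A) :=
  { Algebra.ofModule (R := ℂ) (A := Bidual A)
      (fun c Φ Ψ => rfl)
      (fun c Φ Ψ => by
        ext l
        exact map_smul Φ c (bidualAct Ψ l)) with
    norm_smul_le := fun c Φ => ContinuousLinearMap.opNorm_smul_le c Φ }

end Bidual

end

open Filter Topology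

/-! ### Generalities -/

/-! For each coordinate `i`, let `Φ i` be a weak-star limit of averages over the positive half-line
in direction `e i` minus those over the negative one. It is `e i`-invariant and kills `e
i`-invariant functionals. As `Ψ · (Φ i · l)` is always `e i`-invariant, `Φ i □ Ψ □ Φ i = 0`
(`mul_mul_eq_zero_of_invariant`), so `Φ i` is radical, though it squares to zero. The radical is
closed, so it contains `Φ = ∑ 2⁻ⁱ Φ i`. To see that no power vanishes, test on products of
coordinate signs: `Φ i` deletes the factor at `i` and multiplies by the jump 2, or gives 0 if that
factor is absent. So `Φ` is a lowering operator with positive weights, and `Φ ^ n` is positive on a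
product of `n` signs. -/

/-- An element `x` with `x y x = 0` for every `y` lies in the Jacobson radical. -/
theorem Ring.mem_jacobson_of_forall_mul_mul_eq_zero {R : Type*} [Ring R] {x : R}
    (h : ∀ y, x * y * x = 0) : x ∈ Ring.jacobson R := by
  rw [← Ideal.jacobson_bot, Ideal.mem_jacobson_iff]
  -- Since `y * x` squares to zero, `1 - y * x` inverts `1 + y * x`.
  refine fun y => ⟨1 - y * x, ?_⟩
  have hz : (1 - y * x) * y * x + (1 - y * x) - 1 = -(y * (x * y * x)) := by noncomm_ring
  rw [hz, h, mul_zero, neg_zero]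
  exact Ideal.zero_mem _

/-- The Jacobson radical of a Banach algebra is closed. -/
theorem Ring.isClosed_jacobson (R : Type*) [NormedRing R] [CompleteSpace R] :
    IsClosed (Ring.jacobson R : Set R) := by
  rw [Ring.jacobson_eq_sInf_isMaximal, Submodule.coe_sInf]
  exact isClosed_biInter fun I (hI : Ideal.IsMaximal I) => Ideal.IsMaximal.isClosed

/-- A bounded sequence in a dual space has a weak-star limit along any nonprincipal ultrafilter. -/
theorem StrongDual.exists_tendsto_hyperfilter {E : Type*} [NormedAddCommGroup E]
    [NormedSpace ℂ E] (u : ℕ → StrongDual ℂ E) {C : ℝ} (hu : ∀ n, ‖u n‖ ≤ C) :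
    ∃ Φ : StrongDual ℂ E, ‖Φ‖ ≤ C ∧
      ∀ x, Tendsto (fun n => u n x) (hyperfilter ℕ) (𝓝 (Φ x)) := by
  obtain ⟨Φ, hΦ, hlim⟩ := (WeakDual.isCompact_closedBall (0 : StrongDual ℂ E)
    C).ultrafilter_le_nhds ((hyperfilter ℕ).map fun n => StrongDual.toWeakDual (u n)) (by
      rw [Ultrafilter.coe_map, le_principal_iff, mem_map]
      exact Filter.univ_mem' fun n => by simpa using hu n)
  refine ⟨WeakDual.toStrongDual Φ, by simpa using hΦ, fun x => ?_⟩
  exact ((WeakDual.eval_continuous x).tendsto Φ).comp hlim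

noncomputable section

/-! ### Point masses and bounded functions as functionals -/

namespace EllOne

variable {G : Type*}

open Classical in
/-- The point mass at `s`. -/
def pointMass (s : G) : EllOne G := lp.single 1 s 1

open Classical in
theorem pointMass_apply (s t : G) : pointMass s t = if t = s then 1 else 0 := by
  simp [pointMass, lp.single_apply, Pi.single_apply]

theorem norm_pointMass (s : G) : ‖pointMass s‖ = 1 := by
  simp [pointMass, lp.norm_single]

/-- Functionals on `ℓ¹(G)` are determined by their values at point masses. -/
theorem dual_ext {l m : StrongDual ℂ (EllOne G)} (h : ∀ s, l (pointMass s) = m (pointMass s)) :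
    l = m := by
  classical
  refine lp.ext_continuousLinearMap (by simp) fun s => ?_
  ext
  simpa [pointMass] using h s

/-- The functional on `ℓ¹(G)` given by a function bounded by `1`. -/
def ofBounded (g : G → ℂ) (hg : ∀ s, ‖g s‖ ≤ 1) : StrongDual ℂ (EllOne G) :=
  have hle (f : EllOne G) (s : G) : ‖f s * g s‖ ≤ ‖f s‖ := by
    simpa using mul_le_mul_of_nonneg_left (hg s) (norm_nonneg (f s))
  have hs (f : EllOne G) : Summable fun s => f s * g s :=
    .of_norm_bounded (summable_norm f) (hle f)
  LinearMap.mkContinuous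
    { toFun := fun f => ∑' s, f s * g s
      map_add' := fun f f' => by
        simp only [lp.coeFn_add, Pi.add_apply, add_mul]
        exact (hs f).tsum_add (hs f')
      map_smul' := fun c f => by
        simp [mul_assoc, tsum_mul_left] }
    1 fun f => by
      rw [one_mul, norm_eq]
      exact tsum_of_norm_bounded (summable_norm f).hasSum (hle f)

theorem ofBounded_pointMass (g : G → ℂ) (hg : ∀ s, ‖g s‖ ≤ 1) (s : G) :
    ofBounded g hg (pointMass s) = g s := by
  change ∑' t, pointMass s t * g t = g s
  rw [tsum_eq_single s fun t ht => by simp [pointMass_apply, ht]]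
  simp [pointMass_apply]

section AddGroup

variable [AddGroup G]

theorem pointMass_mul_apply (s : G) (f : EllOne G) (t : G) :
    (pointMass s * f) t = f (-s + t) := by
  rw [mul_apply, tsum_eq_single s fun r hr => by simp [pointMass_apply, hr]]
  simp [pointMass_apply]

theorem pointMass_mul_pointMass (s t : G) :
    pointMass s * pointMass t = pointMass (s + t) := by
  ext r
  rw [pointMass_mul_apply, pointMass_apply, pointMass_apply]
  by_cases h : r = s + t
  · rw [if_pos h, if_pos (neg_add_eq_iff_eq_add.mpr h)]
  · rw [if_neg h, if_neg (mt neg_add_eq_iff_eq_add.mp h)]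

theorem pointMass_zero : pointMass (0 : G) = 1 := by
  ext r
  simp [pointMass_apply, one_apply]

end AddGroup

theorem mul_pointMass_comm [AddCommGroup G] (f : EllOne G) (s : G) :
    f * pointMass s = pointMass s * f := by
  ext t
  rw [pointMass_mul_apply, mul_apply, tsum_eq_single (-s + t)]
  · simp [pointMass_apply]
  · intro r hr
    have : -r + t ≠ s := fun h => hr (by rw [← h]; abel)
    simp [pointMass_apply, this]

end EllOne

open EllOne

/-! ### Radical elements from invariance -/

namespace Bidual

variable {G : Type*} [AddCommGroup G]

/-- If `Φ` is invariant under translation by `e` and kills the `e`-invariant functionals, then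
`Φ □ Ψ □ Φ = 0` for every `Ψ`. -/
theorem mul_mul_eq_zero_of_invariant {Φ : Bidual (EllOne G)} {e : G}
    (hinv : ∀ l, Φ (dualAct l (pointMass e)) = Φ l)
    (hker : ∀ l, dualAct l (pointMass e) = l → Φ l = 0) (Ψ : Bidual (EllOne G)) :
    Φ * Ψ * Φ = 0 := by
  ext l
  change Φ (bidualAct Ψ (bidualAct Φ l)) = 0
  refine hker _ ?_
  -- Commutativity of `G` moves the translation past `a`, where the invariance of `Φ` absorbs it.
  have h1 : dualAct (bidualAct Φ l) (pointMass e) = bidualAct Φ l := by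
    ext a
    rw [dualAct_apply, bidualAct_apply, bidualAct_apply, ← mul_pointMass_comm, ← hinv (dualAct l a)]
    congr 1
    ext b
    simp [mul_assoc]
  ext a
  rw [dualAct_apply, bidualAct_apply, bidualAct_apply]
  congr 1
  ext b
  rw [dualAct_apply, mul_assoc, ← dualAct_apply, h1, dualAct_apply]

/-- The difference of the means of the Følner sets `{k e : 0 ≤ k < N}` and
`{-k e : 0 ≤ k < N}`. -/
def meanDiff (e : G) (N : ℕ) : Bidual (EllOne G) :=
  (N : ℝ)⁻¹ • ∑ k ∈ Finset.range N,
    (NormedSpace.inclusionInDoubleDual ℂ (EllOne G) (pointMass (k • e)) -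
      NormedSpace.inclusionInDoubleDual ℂ (EllOne G) (pointMass (-(k • e))))

theorem meanDiff_apply (e : G) (N : ℕ) (l : StrongDual ℂ (EllOne G)) :
    meanDiff e N l = (N : ℝ)⁻¹ • ∑ k ∈ Finset.range N,
      (l (pointMass (k • e)) - l (pointMass (-(k • e)))) := by
  simp [meanDiff]

theorem norm_apply_pointMass_le (l : StrongDual ℂ (EllOne G)) (s : G) :
    ‖l (pointMass s)‖ ≤ ‖l‖ := by
  simpa [norm_pointMass] using l.le_opNorm (pointMass s)

theorem norm_meanDiff_le (e : G) (N : ℕ) : ‖meanDiff e N‖ ≤ 2 := by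
  refine ContinuousLinearMap.opNorm_le_bound _ zero_le_two fun l => ?_
  have hsum : ‖∑ k ∈ Finset.range N, (l (pointMass (k • e)) - l (pointMass (-(k • e))))‖
      ≤ N * (2 * ‖l‖) := by
    refine (norm_sum_le_of_le _ fun k _ => (norm_sub_le _ _).trans (add_le_add
      (norm_apply_pointMass_le l _) (norm_apply_pointMass_le l _))).trans_eq ?_
    simp [two_mul, mul_add]
  rw [meanDiff_apply, norm_smul, norm_inv, Real.norm_natCast]
  rcases N.eq_zero_or_pos with rfl | hN
  · simp
  · rwa [inv_mul_le_iff₀ (by positivity)]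

/-- Both sums telescope under translation, leaving four boundary terms against the factor `1 / N`.
-/
theorem tendsto_meanDiff_translate_sub (e : G) (l : StrongDual ℂ (EllOne G)) :
    Tendsto (fun N => meanDiff e N (dualAct l (pointMass e)) - meanDiff e N l) atTop (𝓝 0) := by
  have key (N : ℕ) : meanDiff e N (dualAct l (pointMass e)) - meanDiff e N l =
      (N : ℝ)⁻¹ • ((l (pointMass (N • e)) - l (pointMass 0)) +
        (l (pointMass (e - N • e)) - l (pointMass e))) := by
    rw [meanDiff_apply, meanDiff_apply, ← smul_sub, ← Finset.sum_sub_distrib]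
    congr 1
    induction N with
    | zero => simp
    | succ N ih =>
      rw [Finset.sum_range_succ, ih]
      simp only [dualAct_apply, pointMass_mul_pointMass]
      rw [show e + N • e = (N + 1) • e by rw [succ_nsmul'],
        show e + -(N • e) = e - N • e by abel,
        show e - (N + 1) • e = -(N • e) by rw [succ_nsmul]; abel]
      abel
  refine squeeze_zero_norm (a := fun N : ℕ => (N : ℝ)⁻¹ * (4 * ‖l‖)) (fun N => ?_) ?_
  · rw [key, norm_smul, norm_inv, Real.norm_natCast]
    refine mul_le_mul_of_nonneg_left ?_ (by positivity)
    refine (norm_add_le_of_le (norm_sub_le _ _) (norm_sub_le _ _)).trans ?_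
    linarith [norm_apply_pointMass_le l (N • e), norm_apply_pointMass_le l (0 : G),
      norm_apply_pointMass_le l (e - N • e), norm_apply_pointMass_le l e]
  · simpa using (tendsto_inv_atTop_nhds_zero_nat (𝕜 := ℝ)).mul_const (4 * ‖l‖)

theorem meanDiff_apply_of_invariant (e : G) (N : ℕ) {l : StrongDual ℂ (EllOne G)}
    (hl : dualAct l (pointMass e) = l) : meanDiff e N l = 0 := by
  have hstep (s : G) : l (pointMass (e + s)) = l (pointMass s) := by
    rw [← pointMass_mul_pointMass, ← dualAct_apply, hl]
  have hpos (k : ℕ) : l (pointMass (k • e)) = l (pointMass 0) := by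
    induction k with
    | zero => simp
    | succ k ih => rw [succ_nsmul', hstep, ih]
  have hneg (k : ℕ) : l (pointMass (-(k • e))) = l (pointMass 0) := by
    induction k with
    | zero => simp
    | succ k ih =>
      rw [← hstep, ← ih]
      congr 2
      rw [succ_nsmul]
      abel
  rw [meanDiff_apply]
  simp [hpos, hneg]

/-- A difference of two invariant means along the cyclic subgroup generated by `e`. -/
theorem exists_tendsto_meanDiff (e : G) :
    ∃ Φ : Bidual (EllOne G), ‖Φ‖ ≤ 2 ∧ Φ ∈ Ring.jacobson (Bidual (EllOne G)) ∧
      ∀ l c, Tendsto (fun N => meanDiff e N l) atTop (𝓝 c) → Φ l = c := by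
  obtain ⟨Φ, hnorm, hlim⟩ := StrongDual.exists_tendsto_hyperfilter (meanDiff e)
    (norm_meanDiff_le e)
  have hle : (hyperfilter ℕ : Filter ℕ) ≤ atTop := Nat.hyperfilter_le_atTop
  -- A nonprincipal ultrafilter refines `atTop`, so ordinary limits determine `Φ`.
  have hval (l c) (h : Tendsto (fun N => meanDiff e N l) atTop (𝓝 c)) : Φ l = c :=
    tendsto_nhds_unique (hlim l) (h.mono_left hle)
  refine ⟨Φ, hnorm, Ring.mem_jacobson_of_forall_mul_mul_eq_zero
    (mul_mul_eq_zero_of_invariant (e := e) (fun l => ?_) fun l hl => ?_), hval⟩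
  · rw [← sub_eq_zero]
    exact tendsto_nhds_unique ((hlim _).sub (hlim l))
      ((tendsto_meanDiff_translate_sub e l).mono_left hle)
  · exact hval l 0 (by simp [meanDiff_apply_of_invariant e _ hl])

end Bidual


open Bidual

/-! ### Detecting powers by products of signs -/

theorem norm_prod_sign_le (S : Finset ℕ) (s : ℕ →₀ ℤ) :
    ‖∏ j ∈ S, ((s j).sign : ℂ)‖ ≤ 1 := by
  rw [norm_prod]
  refine Finset.prod_le_one (fun _ _ => norm_nonneg _) fun j _ => ?_
  rcases Int.sign_trichotomy (s j) with h | h | h <;> simp [h]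

/-- The functional on `ℓ¹(⨁ ℤ)` given by the function `s ↦ ∏ j ∈ S, sign (s j)`. -/
def signProd (S : Finset ℕ) : StrongDual ℂ (EllOne (ℕ →₀ ℤ)) :=
  ofBounded _ (norm_prod_sign_le S)

theorem signProd_pointMass (S : Finset ℕ) (s : ℕ →₀ ℤ) :
    signProd S (pointMass s) = ∏ j ∈ S, ((s j).sign : ℂ) :=
  ofBounded_pointMass _ _ s

theorem tendsto_sign_add_sub (a : ℤ) :
    Tendsto (fun k : ℕ => (((a + k).sign : ℂ) - ((a - k).sign : ℂ))) atTop (𝓝 2) := by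
  refine tendsto_const_nhds.congr' ?_
  filter_upwards [eventually_gt_atTop a.natAbs] with k hk
  rw [Int.sign_eq_one_of_pos (by omega), Int.sign_eq_neg_one_of_neg (by omega)]
  norm_num

/-- Moving along coordinate `i` changes only the factor at `i`. Its signs at the two ends differ by
2; without that factor the two averages cancel. -/
theorem tendsto_meanDiff_signProd (i : ℕ) (S : Finset ℕ) (t : ℕ →₀ ℤ) :
    Tendsto (fun N => meanDiff (Finsupp.single i 1) N (dualAct (signProd S) (pointMass t))) atTop
      (𝓝 (if i ∈ S then 2 * signProd (S.erase i) (pointMass t) else 0)) := by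
  have hval (c : ℤ) : dualAct (signProd S) (pointMass t) (pointMass (Finsupp.single i c)) =
      if i ∈ S then ((t i + c).sign : ℂ) * signProd (S.erase i) (pointMass t)
      else signProd S (pointMass t) := by
    rw [dualAct_apply, pointMass_mul_pointMass, signProd_pointMass]
    split_ifs with hi
    · rw [← Finset.mul_prod_erase S _ hi, signProd_pointMass]
      congr 1
      · simp
      · refine Finset.prod_congr rfl fun j hj => ?_
        simp [(Finset.ne_of_mem_erase hj)]
    · rw [signProd_pointMass]
      refine Finset.prod_congr rfl fun j hj => ?_
      simp [show j ≠ i from fun h => hi (h ▸ hj)]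
  simp only [meanDiff_apply, Finsupp.smul_single, ← Finsupp.single_neg, hval]
  split_ifs with hi
  · refine Tendsto.cesaro_smul ?_
    refine ((tendsto_sign_add_sub (t i)).mul_const (signProd (S.erase i) (pointMass t))).congr
      fun k => ?_
    rw [sub_mul]
    simp [sub_eq_add_neg]
  · simp

/-- The Jacobson radical of `ℓ¹(⨁ ℤ)''` contains an element whose action on the functionals
`signProd S` removes one index of `S` at a time. -/
theorem exists_mem_jacobson_bidualAct_signProd :
    ∃ Φ ∈ Ring.jacobson (Bidual (EllOne (ℕ →₀ ℤ))), ∀ S : Finset ℕ,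
      bidualAct Φ (signProd S) =
        ∑ i ∈ S, (((1 / 2 : ℝ) ^ i * 2 : ℝ) : ℂ) • signProd (S.erase i) := by
  choose Φ hnorm hrad hval using fun i : ℕ =>
    exists_tendsto_meanDiff (Finsupp.single i 1 : ℕ →₀ ℤ)
  have hsum : Summable fun i => (((1 / 2 : ℝ) ^ i : ℝ) : ℂ) • Φ i := by
    refine .of_norm_bounded (summable_geometric_two.mul_right 2) fun i => ?_
    rw [norm_smul, Complex.norm_of_nonneg (by positivity)]
    exact mul_le_mul_of_nonneg_left (hnorm i) (by positivity)
  refine ⟨∑' i, (((1 / 2 : ℝ) ^ i : ℝ) : ℂ) • Φ i, ?_, fun S => dual_ext fun t => ?_⟩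
  · refine (Ring.isClosed_jacobson _).mem_of_tendsto hsum.hasSum (.of_forall fun s => ?_)
    refine Submodule.sum_mem _ fun i _ => ?_
    -- The radical is a left ideal, so the scalar is written as a left multiplier.
    rw [← smul_one_mul]
    exact Ideal.mul_mem_left _ _ (hrad i)
  · have happ (l : StrongDual ℂ (EllOne (ℕ →₀ ℤ))) :
        (∑' i, (((1 / 2 : ℝ) ^ i : ℝ) : ℂ) • Φ i) l =
          ∑' i, (((1 / 2 : ℝ) ^ i : ℝ) : ℂ) * Φ i l :=
      (ContinuousLinearMap.apply ℂ ℂ l).map_tsum hsum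
    rw [bidualAct_apply, happ, tsum_eq_sum (s := S)]
    · rw [_root_.sum_apply]
      refine Finset.sum_congr rfl fun i hi => ?_
      rw [hval i _ _ (tendsto_meanDiff_signProd i S t), if_pos hi]
      simp [mul_assoc]
    · intro i hi
      rw [hval i _ _ (tendsto_meanDiff_signProd i S t), if_neg hi, mul_zero]

end

theorem mainTheorem4 :
    ∃ Φ : Bidual (EllOne (ℕ →₀ ℤ)),
      Φ ∈ Ring.jacobson (Bidual (EllOne (ℕ →₀ ℤ))) ∧ ¬ IsNilpotent Φ := by
  obtain ⟨Φ, hΦ, hact⟩ := exists_mem_jacobson_bidualAct_signProd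
  -- Positivity, rather than mere nonvanishing, rules out cancellation in the sum over the deleted
  -- index.
  have hpow (n : ℕ) (S : Finset ℕ) (hS : S.card = n) :
      ∃ r : ℝ, 0 < r ∧ (Φ ^ n) (signProd S) = r := by
    induction n generalizing S with
    | zero =>
      refine ⟨1, one_pos, ?_⟩
      rw [Finset.card_eq_zero.mp hS, pow_zero, Bidual.one_apply, ← EllOne.pointMass_zero,
        signProd_pointMass]
      simp
    | succ n ih =>
      choose! r hr0 hr using ih
      have hcard (i : ℕ) (hi : i ∈ S) : (S.erase i).card = n := by
        rw [Finset.card_erase_of_mem hi, hS, Nat.add_sub_cancel]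
      refine ⟨∑ i ∈ S, (1 / 2 : ℝ) ^ i * 2 * r (S.erase i), Finset.sum_pos (fun i hi => ?_)
        (Finset.card_pos.mp (by omega)), ?_⟩
      · have := hr0 _ (hcard i hi)
        positivity
      -- The rightmost factor acts on the functional first, which reduces to sets with `n` elements.
      · rw [pow_succ, Bidual.mul_apply, hact, map_sum, Complex.ofReal_sum]
        refine Finset.sum_congr rfl fun i hi => ?_
        rw [map_smul, hr _ (hcard i hi), smul_eq_mul, ← Complex.ofReal_mul]
  refine ⟨Φ, hΦ, fun ⟨n, hn⟩ => ?_⟩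
  obtain ⟨r, hr0, hr⟩ := hpow n (Finset.range n) (Finset.card_range n)
  rw [hn] at hr
  exact hr0.ne (Complex.ofReal_injective hr)
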